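/- For a positive integer $n$, let $Q(n)$ denote the number of partitions of $n$ into distinct parts. A generalized pentagonal number is an integer of the form $t(3t-1)/2$ with $t\in\mathbb{Z}$ (so $0$ is included). Let $v_n=1$ if $n$ is a generalized pentagonal number and $v_n=0$ otherwise. Let $w_n$ denote the number of representations of $n$ as a generalized pentagonal number plus three times a positive square, i.e. the number of pairs $(p,s)$ such that $p$ is a generalized pentagonal number, $s=m^2$ for some integer $m\ge 1$, and $p+3s=n$. Then for every positive integer $N$, $$Q(N)\equiv v_N+2w_N \pmod 4.$$ -/

import Mathlib

/-- `n` is a generalized pentagonal number: `n = t(3t-1)/2` for some integer `t`. -/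
def IsGeneralizedPentagonal (n : ℕ) : Prop :=
  ∃ t : ℤ, n = pentagonal t

/-- `Q(n)`: the number of partitions of `n` into distinct parts. -/
def numDistinctPartitions (n : ℕ) : ℕ :=
  (Nat.Partition.distincts n).card

open Classical in
/-- `v_n`: the indicator that `n` is a generalized pentagonal number. -/
noncomputable def pentagonalIndicator (n : ℕ) : ℕ :=
  if IsGeneralizedPentagonal n then 1 else 0

/-- The representations `n = p + 3 s` with `p` a generalized pentagonal number (possibly `0`) and
`s` the square of a positive integer, as pairs `(p, s)` of numbers. -/
def pentagonalSquareReps (n : ℕ) : Set (ℕ × ℕ) :=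
  {x | IsGeneralizedPentagonal x.1 ∧ (∃ m : ℕ, 0 < m ∧ x.2 = m ^ 2) ∧ x.1 + 3 * x.2 = n}

/-- The set of representations is finite, so its `ncard` is its number of elements. -/
theorem pentagonalSquareReps_finite (n : ℕ) : (pentagonalSquareReps n).Finite := by
  refine ((Set.finite_Iic n).prod (Set.finite_Iic n)).subset ?_
  rintro ⟨p, s⟩ ⟨_, _, h⟩
  simp only [Set.mem_prod, Set.mem_Iic] at h ⊢
  omega

/-- `w_n`: the number of representations of `n` as a generalized pentagonal number plus three
times a positive square. -/
noncomputable def numPentagonalSquareReps (n : ℕ) : ℕ :=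
  (pentagonalSquareReps n).ncard

/-! With c = ab, the Jacobi triple product at (a, b) = (q, q²) gives P = Σ q^(t(3t-1)/2); at a = b =
-q³ it gives 1 + 2S, S = Σ_{m≥1} (-1)^m q^(3m²). Comparing the products, ∏(1 + q^i) · (1 + 2S) = P.
Since (1 + 2S)² ≡ 1 mod 4, ∏(1 + q^i) ≡ P(1 + 2S) mod 4, and the signs in S do not matter there.
Coefficients of q^N give the claim. Infinite products are avoided: identities hold modulo X ^ (n +
1), starting from the finite triple product `prod_eq_sum_gaussBinom`. -/

open Finset PowerSeries

/-! ### Gaussian binomials and the q-binomial theorem -/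

section GaussBinomial

variable {R : Type*} [CommRing R]

/-- The Gaussian binomial coefficient `[k + l choose k]` with base `c`. -/
def gaussBinom (c : R) : ℕ → ℕ → R
  | 0, _ => 1
  | _ + 1, 0 => 1
  | k + 1, l + 1 => gaussBinom c k (l + 1) + c ^ (k + 1) * gaussBinom c (k + 1) l

/-- The finite `q`-Pochhammer symbol `(c; c)_n`. -/
def pochProd (c : R) (n : ℕ) : R := ∏ i ∈ range n, (1 - c ^ (i + 1))

theorem gaussBinom_zero_left (c : R) (l : ℕ) : gaussBinom c 0 l = 1 := by
  simp [gaussBinom]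

theorem gaussBinom_zero_right (c : R) (k : ℕ) : gaussBinom c k 0 = 1 := by
  cases k <;> simp [gaussBinom]

theorem gaussBinom_succ_succ (c : R) (k l : ℕ) : gaussBinom c (k + 1) (l + 1) =
    gaussBinom c k (l + 1) + c ^ (k + 1) * gaussBinom c (k + 1) l := by
  rw [gaussBinom]

theorem pochProd_succ (c : R) (n : ℕ) :
    pochProd c (n + 1) = pochProd c n * (1 - c ^ (n + 1)) := by
  simp [pochProd, prod_range_succ]

theorem gaussBinom_mul_pochProd (c : R) (k l : ℕ) :
    gaussBinom c k l * (pochProd c k * pochProd c l) = pochProd c (k + l) := by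
  induction k generalizing l with
  | zero => simp [gaussBinom_zero_left, pochProd]
  | succ k ihk =>
    induction l with
    | zero => simp [gaussBinom_zero_right, pochProd]
    | succ l ihl =>
      have h1 := ihk (l + 1)
      rw [show k + 1 + (l + 1) = k + l + 1 + 1 by ring, pochProd_succ c (k + l + 1),
        gaussBinom_succ_succ]
      rw [show k + (l + 1) = k + l + 1 by ring] at h1
      rw [show k + 1 + l = k + l + 1 by ring] at ihl
      calc _ = (1 - c ^ (k + 1)) * (gaussBinom c k (l + 1) * (pochProd c k * pochProd c (l + 1)))
            + c ^ (k + 1) * (1 - c ^ (l + 1)) *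
              (gaussBinom c (k + 1) l * (pochProd c (k + 1) * pochProd c l)) := by
            rw [pochProd_succ c k, pochProd_succ c l]; ring
        _ = _ := by rw [h1, ihl]; ring

theorem sum_antidiagonal_succ_of_pascal (u A B : ℕ → ℕ → R) (h0 : ∀ l, u 0 (l + 1) = B 0 l)
    (h1 : ∀ k, u (k + 1) 0 = A k 0)
    (h2 : ∀ k l, u (k + 1) (l + 1) = A k (l + 1) + B (k + 1) l) (n : ℕ) :
    ∑ p ∈ antidiagonal (n + 1), u p.1 p.2 =
      ∑ p ∈ antidiagonal n, A p.1 p.2 + ∑ p ∈ antidiagonal n, B p.1 p.2 := by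
  rw [Finset.Nat.sum_antidiagonal_succ]
  cases n with
  | zero => simp [h0, h1, add_comm]
  | succ m =>
    rw [Finset.Nat.sum_antidiagonal_succ', Finset.Nat.sum_antidiagonal_succ' (f := fun p ↦ A p.1 p.2),
      Finset.Nat.sum_antidiagonal_succ (f := fun p ↦ B p.1 p.2)]
    simp only [h0, h1, h2, sum_add_distrib]
    ring

/-- The q-binomial theorem, homogeneous in y and z. Removing the factor i = 0 replaces z by z * c,
and the Pascal rule absorbs the factor y + z. -/
theorem prod_add_mul_pow (c y z : R) (n : ℕ) :
    ∏ i ∈ range n, (y + z * c ^ i) = ∑ p ∈ antidiagonal n,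
      c ^ (p.1.choose 2) * gaussBinom c p.1 p.2 * z ^ p.1 * y ^ p.2 := by
  induction n generalizing z with
  | zero => simp [gaussBinom_zero_left]
  | succ n ih =>
    rw [prod_range_succ']
    have h (i : ℕ) : y + z * c ^ (i + 1) = y + z * c * c ^ i := by ring
    simp only [h]
    rw [ih, sum_antidiagonal_succ_of_pascal
      (fun k l ↦ c ^ (k.choose 2) * gaussBinom c k l * z ^ k * y ^ l)
      (fun k l ↦ z * (c ^ (k.choose 2) * gaussBinom c k l * (z * c) ^ k * y ^ l))
      (fun k l ↦ y * (c ^ (k.choose 2) * gaussBinom c k l * (z * c) ^ k * y ^ l)),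
      ← mul_sum, ← mul_sum]
    · ring
    · intro l
      simp [gaussBinom_zero_left]; ring
    · intro k
      rw [Nat.choose_succ_succ' k 1]
      simp [gaussBinom_zero_right]; ring
    · intro k l
      rw [gaussBinom_succ_succ, Nat.choose_succ_succ' k 1]
      simp; ring

end GaussBinomial

/-- The triangular number `j (j + 1) / 2` of an integer `j`. -/
def triangular (j : ℤ) : ℕ := (j * (j + 1) / 2).toNat

theorem two_mul_triangular (j : ℤ) : 2 * (triangular j : ℤ) = j * (j + 1) := by
  have h : 0 ≤ j * (j + 1) := by
    rcases le_or_gt 0 j with h | h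
    · positivity
    · exact mul_nonneg_of_nonpos_of_nonpos h.le (by omega)
  rw [triangular, Int.toNat_of_nonneg (by positivity), 
    Int.two_mul_ediv_two_of_even (Int.even_mul_succ_self j)]

theorem natAbs_le_triangular_add (j : ℤ) : j.natAbs ≤ triangular j + triangular (-j) := by
  have h1 := two_mul_triangular j
  have h2 := two_mul_triangular (-j)
  zify
  rcases le_total 0 j with h | h
  · rw [abs_of_nonneg h]; nlinarith
  · rw [abs_of_nonpos h]; nlinarith

theorem sum_antidiagonal_two_mul {M : Type*} [AddCommMonoid M] (n : ℕ) (f : ℕ × ℕ → M) :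
    ∑ p ∈ antidiagonal (2 * n), f p =
      ∑ j ∈ Icc (-n : ℤ) n, f ((n + j).toNat, (n - j).toNat) := by
  refine sum_nbij' (fun p ↦ (p.1 : ℤ) - n) (fun j ↦ ((n + j).toNat, (n - j).toNat)) ?_ ?_ ?_ ?_ ?_
  · intro p hp; simp at hp ⊢; omega
  · intro j hj; simp at hj ⊢; omega
  · rintro ⟨k, l⟩ hp; simp at hp ⊢; omega
  · intro j hj; simp at hj ⊢; omega
  · rintro ⟨k, l⟩ hp
    simp at hp ⊢
    congr 2
    omega

/-! ### Finite triple product and its truncation -/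

section TripleProduct

variable {R : Type*} [CommRing R]

/-- Factors with i ≥ n yield 1 + a(ab)^(i-n). For i < n, pulling out a(ab)^i leaves 1 +
b(ab)^(n-1-i), hence the reflection. -/
theorem prod_add_mul_pow_two_mul (a b : R) (n : ℕ) :
    ∏ i ∈ range (2 * n), ((a * b) ^ n + a * (a * b) ^ i) =
      a ^ n * (a * b) ^ (n * n + n.choose 2) *
        ∏ i ∈ range n, ((1 + a * (a * b) ^ i) * (1 + b * (a * b) ^ i)) := by
  rw [two_mul, prod_range_add, prod_mul_distrib]
  have h1 : ∏ i ∈ range n, ((a * b) ^ n + a * (a * b) ^ (n + i)) =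
      (a * b) ^ (n * n) * ∏ i ∈ range n, (1 + a * (a * b) ^ i) := by
    have (i : ℕ) : (a * b) ^ n + a * (a * b) ^ (n + i) =
      (a * b) ^ n * (1 + a * (a * b) ^ i) := by ring
    simp only [this, prod_mul_distrib, prod_const, card_range, ← pow_mul]
  have h2 : ∏ i ∈ range n, ((a * b) ^ n + a * (a * b) ^ i) =
      a ^ n * (a * b) ^ n.choose 2 * ∏ i ∈ range n, (1 + b * (a * b) ^ i) := by
    have han : a ^ n = ∏ i ∈ range n, a := by simp
    rw [← prod_range_reflect (fun i ↦ 1 + b * (a * b) ^ i), Nat.choose_two_right, ← sum_range_id,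
      ← prod_pow_eq_pow_sum, han, ← prod_mul_distrib, ← prod_mul_distrib]
    refine prod_congr rfl fun i hi ↦ ?_
    obtain ⟨m, rfl⟩ := Nat.exists_eq_add_of_lt (mem_range.1 hi)
    rw [show i + m + 1 - 1 - i = m by omega]
    ring
  rw [h1, h2]; ring

/-- A finite form of the Jacobi triple product identity. -/
theorem prod_eq_sum_gaussBinom [IsDomain R] {a b : R} (ha : a ≠ 0) (hb : b ≠ 0) (n : ℕ) :
    ∏ i ∈ range n, ((1 + a * (a * b) ^ i) * (1 + b * (a * b) ^ i)) =
      ∑ j ∈ Icc (-n : ℤ) n, gaussBinom (a * b) (n + j).toNat (n - j).toNat *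
        (a ^ triangular j * b ^ triangular (-j)) := by
  have hne : a ^ n * (a * b) ^ (n * n + n.choose 2) ≠ 0 := by simp [ha, hb]
  apply mul_left_cancel₀ hne
  rw [← prod_add_mul_pow_two_mul, prod_add_mul_pow, sum_antidiagonal_two_mul, mul_sum]
  refine sum_congr rfl fun j hj ↦ ?_
  obtain ⟨k, hk⟩ := Int.eq_ofNat_of_zero_le (show 0 ≤ n + j by simp at hj; omega)
  obtain ⟨l, hl⟩ := Int.eq_ofNat_of_zero_le (show 0 ≤ n - j by simp at hj; omega)
  simp only [hk, hl, Int.toNat_natCast]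
  have e1 := two_mul_triangular j
  have e2 := two_mul_triangular (-j)
  have c1 (m : ℕ) : 2 * (m.choose 2 : ℤ) = m * (m - 1) := by
    have := Nat.choose_two_right m
    have h := Nat.div_mul_cancel (Nat.even_mul_pred_self m).two_dvd
    rw [← this] at h
    rcases m with _ | m
    · simp
    · push_cast [← h]
      simp at h
      zify at h
      linarith
  have h1 : k.choose 2 + k + n * l = n + (n * n + n.choose 2) + triangular j := by
    have := c1 k
    have := c1 n
    obtain rfl : j = k - n := by omega
    zify
    have hl' : (l : ℤ) = 2 * n - k := by omega
    rw [hl']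
    nlinarith
  have h2 : k.choose 2 + n * l = (n * n + n.choose 2) + triangular (-j) := by
    have := c1 k
    have := c1 n
    obtain rfl : j = k - n := by omega
    zify
    have hl' : (l : ℤ) = 2 * n - k := by omega
    rw [hl']
    nlinarith
  calc _ = gaussBinom (a * b) k l * (a ^ (k.choose 2 + k + n * l) * b ^ (k.choose 2 + n * l)) := by
        ring
    _ = _ := by rw [h1, h2]; ring

theorem pochProd_sub_dvd (c : R) {m n : ℕ} (h : m ≤ n) :
    c ^ (m + 1) ∣ pochProd c n - pochProd c m := by
  induction n, h using Nat.le_induction with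
  | base => simp
  | succ n hn ih =>
    rw [pochProd_succ]
    have : c ^ (m + 1) ∣ c ^ (n + 1) := pow_dvd_pow _ (by omega)
    have := ih.sub (this.mul_left (pochProd c n))
    convert this using 1
    ring

/-- `(c; c)_n [k + l choose k] ≡ 1` modulo `c ^ (m + 1)` as soon as `k, l, n ≥ m`. -/
theorem pochProd_mul_gaussBinom_sub_one_dvd {c : R} {k l m n : ℕ}
    (hc : ∀ i, IsUnit (pochProd c i)) (hk : m ≤ k) (hl : m ≤ l) (hn : m ≤ n) :
    c ^ (m + 1) ∣ pochProd c n * gaussBinom c k l - 1 := by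
  -- Modulo c ^ (m + 1) every Pochhammer symbol of index ≥ m equals one unit u, so the product
  -- formula reads [k + l choose k] u² = u.
  have key (i : ℕ) (hi : m ≤ i) :
      Ideal.Quotient.mk (Ideal.span {c ^ (m + 1)}) (pochProd c i) =
        Ideal.Quotient.mk (Ideal.span {c ^ (m + 1)}) (pochProd c m) := by
    rw [Ideal.Quotient.eq, Ideal.mem_span_singleton]
    exact pochProd_sub_dvd c hi
  rw [← Ideal.mem_span_singleton, ← Ideal.Quotient.eq]
  have h := congrArg (Ideal.Quotient.mk (Ideal.span {c ^ (m + 1)})) (gaussBinom_mul_pochProd c k l)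
  simp only [map_mul, key k hk, key l hl, key n hn, key (k + l) (by omega), map_one] at h ⊢
  have hu := (hc m).map (Ideal.Quotient.mk (Ideal.span {c ^ (m + 1)}))
  apply hu.mul_left_cancel
  linear_combination h

end TripleProduct

theorem isUnit_pochProd {R : Type*} [CommRing R] {c : R⟦X⟧} (hc : X ∣ c) (n : ℕ) :
    IsUnit (pochProd c n) := by
  rw [PowerSeries.isUnit_iff_constantCoeff, pochProd, map_prod]
  rw [X_dvd_iff] at hc
  simp [hc]

/-- The Jacobi triple product identity modulo `X ^ (n + 1)`. -/
theorem X_pow_dvd_tripleProduct {R : Type*} [CommRing R] [IsDomain R] {a b : R⟦X⟧}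
    (ha : a ≠ 0) (hb : b ≠ 0) (hXa : X ∣ a) (hXb : X ∣ b) (n : ℕ) :
    X ^ (n + 1) ∣ pochProd (a * b) n *
        ∏ i ∈ range n, ((1 + a * (a * b) ^ i) * (1 + b * (a * b) ^ i)) -
      ∑ j ∈ Icc (-n : ℤ) n, a ^ triangular j * b ^ triangular (-j) := by
  rw [prod_eq_sum_gaussBinom ha hb, mul_sum, ← sum_sub_distrib]
  refine dvd_sum fun j hj ↦ ?_
  rw [mem_Icc] at hj
  -- The j-th coefficient is 1 only to precision n - |j| + 1; the monomial beside it, of order at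
  -- least |j|, makes up the loss.
  have h1 := pochProd_mul_gaussBinom_sub_one_dvd (c := a * b) (k := (n + j).toNat)
    (l := (n - j).toNat) (m := n - j.natAbs) (n := n) (isUnit_pochProd (hXa.mul_right b))
    (by omega) (by omega) (by omega)
  have h2 : X ^ (triangular j + triangular (-j)) ∣ a ^ triangular j * b ^ triangular (-j) := by
    rw [pow_add]
    exact mul_dvd_mul (pow_dvd_pow_of_dvd hXa _) (pow_dvd_pow_of_dvd hXb _)
  have h3 : X ^ (n - j.natAbs + 1) ∣ (a * b) ^ (n - j.natAbs + 1) :=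
    pow_dvd_pow_of_dvd (hXa.mul_right b) _
  have h4 := mul_dvd_mul (h3.trans h1) h2
  rw [← pow_add] at h4
  have h5 := natAbs_le_triangular_add j
  refine (pow_dvd_pow _ (by omega)).trans (h4.trans (dvd_of_eq ?_))
  ring

/-! ### Generating functions over ℤ -/

-- Convergence to Euler's product makes each coefficient eventually constant; n₀ serves the first N
-- + 1 of them.
open scoped PowerSeries.WithPiTopology in
theorem exists_X_pow_dvd_numDistinctPartitions_sub (N : ℕ) : ∃ n₀, ∀ n ≥ n₀,
    (X : ℤ⟦X⟧) ^ (N + 1) ∣ PowerSeries.mk (fun n ↦ (numDistinctPartitions n : ℤ)) -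
      ∏ i ∈ range n, (1 + X ^ (i + 1)) := by
  have h := Nat.Partition.hasProd_powerSeriesMk_card_countRestricted ℤ two_pos
  rw [HasProd, WithPiTopology.tendsto_iff_coeff_tendsto] at h
  have h' : ∀ d ∈ range (N + 1), ∀ᶠ n in Filter.atTop,
      coeff d (∏ i ∈ range n, (1 + X ^ (i + 1) : ℤ⟦X⟧)) = (numDistinctPartitions d : ℤ) := by
    intro d _
    have hd := (h d).comp Filter.tendsto_finset_range
    simp only [nhds_discrete] at hd
    have := Filter.tendsto_pure.1 hd
    filter_upwards [this] with n hn
    have hg (i : ℕ) : ∑ j ∈ range 2, (X : ℤ⟦X⟧) ^ ((i + 1) * j) = 1 + X ^ (i + 1) := by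
      rw [sum_range_succ, sum_range_one, mul_zero, pow_zero, mul_one]
    simp only [Function.comp_apply, hg, coeff_mk, Nat.Partition.countRestricted_two] at hn
    exact hn
  rw [← Filter.eventually_all_finset] at h'
  obtain ⟨n₀, hn₀⟩ := Filter.eventually_atTop.1 h'
  refine ⟨n₀, fun n hn ↦ X_pow_dvd_iff.2 fun d hd ↦ ?_⟩
  rw [map_sub, hn₀ n hn d (mem_range.2 hd), coeff_mk, sub_self]

theorem prod_range_two_mul {M : Type*} [CommMonoid M] (f : ℕ → M) (n : ℕ) :
    ∏ i ∈ range (2 * n), f i = ∏ i ∈ range n, (f (2 * i) * f (2 * i + 1)) := by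
  induction n with
  | zero => simp
  | succ n ih =>
    rw [show 2 * (n + 1) = 2 * n + 1 + 1 by ring, prod_range_succ, prod_range_succ, ih,
      prod_range_succ, mul_assoc]

theorem prod_range_three_mul {M : Type*} [CommMonoid M] (f : ℕ → M) (n : ℕ) :
    ∏ i ∈ range (3 * n), f i =
      ∏ i ∈ range n, (f (3 * i) * f (3 * i + 1) * f (3 * i + 2)) := by
  induction n with
  | zero => simp
  | succ n ih =>
    rw [show 3 * (n + 1) = 3 * n + 1 + 1 + 1 by ring, prod_range_succ, prod_range_succ,
      prod_range_succ, ih, prod_range_succ]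
    simp only [mul_assoc]

/-- The partial sums of `∑ X ^ (t (3 t - 1) / 2)` over the integers `t`. -/
noncomputable def pentagonalSum (n : ℕ) : ℤ⟦X⟧ := ∑ j ∈ Icc (-n : ℤ) n, X ^ pentagonal j

/-- The partial sums of `∑ (-1) ^ m X ^ (3 m ^ 2)` over the positive integers `m`. -/
noncomputable def signedSquareSum (n : ℕ) : ℤ⟦X⟧ :=
  ∑ m ∈ Icc 1 n, (-1) ^ m * X ^ (3 * m ^ 2)

/-- The partial sums of `∑ X ^ (3 m ^ 2)` over the positive integers `m`. -/
noncomputable def squareSum (n : ℕ) : ℤ⟦X⟧ := ∑ m ∈ Icc 1 n, X ^ (3 * m ^ 2)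

theorem X_pow_dvd_sub_pentagonalSum (n : ℕ) :
    (X : ℤ⟦X⟧) ^ (n + 1) ∣ pochProd (X ^ 3) n *
      ∏ i ∈ range n, ((1 + X ^ (3 * i + 1)) * (1 + X ^ (3 * i + 2))) - pentagonalSum n := by
  have h := X_pow_dvd_tripleProduct (R := ℤ) (a := X) (b := X ^ 2) X_ne_zero (by simp)
    dvd_rfl (dvd_pow_self _ two_ne_zero) n
  rw [show (X * X ^ 2 : ℤ⟦X⟧) = X ^ 3 by ring] at h
  convert h using 2
  · congr 1
    refine prod_congr rfl fun i _ ↦ ?_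
    ring
  · refine sum_congr rfl fun j _ ↦ ?_
    rw [← pow_mul, ← pow_add]
    congr 1
    have := two_mul_triangular j
    have := two_mul_triangular (-j)
    have := two_mul_natCast_pentagonal j
    zify
    linarith

theorem sum_Icc_neg_eq {M : Type*} [AddCommMonoid M] (f : ℤ → M) (hf : ∀ j, f (-j) = f j)
    (n : ℕ) : ∑ j ∈ Icc (-n : ℤ) n, f j = f 0 + 2 • ∑ m ∈ Icc 1 n, f m := by
  induction n with
  | zero => simp
  | succ n ih =>
    have : Icc (-(n + 1 : ℕ) : ℤ) (n + 1 : ℕ) =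
        insert (-(n + 1 : ℤ)) (insert (n + 1 : ℤ) (Icc (-n : ℤ) n)) := by
      ext; simp; omega
    rw [this, sum_insert (by simp; omega), sum_insert (by simp), ih,
      sum_Icc_succ_top (by omega), hf]
    simp only [two_nsmul, Nat.cast_add, Nat.cast_one]
    abel

theorem X_pow_dvd_sub_signedSquareSum (n : ℕ) :
    (X : ℤ⟦X⟧) ^ (n + 1) ∣ pochProd (X ^ 6) n *
      ∏ i ∈ range n, (1 - X ^ (6 * i + 3)) ^ 2 - (1 + 2 * signedSquareSum n) := by
  have hX : (X : ℤ⟦X⟧) ∣ -X ^ 3 := (dvd_pow_self _ three_ne_zero).neg_right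
  have h := X_pow_dvd_tripleProduct (R := ℤ) (a := -X ^ 3) (b := -X ^ 3) (by simp) (by simp)
    hX hX n
  have h6 : (-X ^ 3 * -X ^ 3 : ℤ⟦X⟧) = X ^ 6 := by ring
  rw [h6] at h
  convert h using 2
  · congr 1
    refine prod_congr rfl fun i _ ↦ ?_
    ring
  · rw [sum_Icc_neg_eq _ (fun j ↦ by rw [neg_neg, mul_comm])]
    simp only [signedSquareSum, nsmul_eq_mul, Nat.cast_ofNat]
    congr 1
    · simp [triangular]
    congr 1
    refine sum_congr rfl fun m _ ↦ ?_
    have : triangular m + triangular (-m) = m ^ 2 := by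
      have := two_mul_triangular m
      have := two_mul_triangular (-m)
      zify
      linarith
    rw [← pow_add, this, neg_pow (X ^ 3), ← pow_mul]
    congr 1
    rcases Nat.even_or_odd m with hm | hm
    · rw [hm.neg_one_pow, (hm.pow_of_ne_zero two_ne_zero).neg_one_pow]
    · rw [hm.neg_one_pow, hm.pow.neg_one_pow]

/-- The identity `f(q, q²) = (-q; q)_∞ φ(-q³)` modulo `X ^ (n + 1)`. -/
theorem X_pow_dvd_prod_mul_sub_pentagonalSum (n : ℕ) :
    (X : ℤ⟦X⟧) ^ (n + 1) ∣ (∏ i ∈ range (3 * n), (1 + X ^ (i + 1))) *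
      (1 + 2 * signedSquareSum n) - pentagonalSum n := by
  set A : ℤ⟦X⟧ := ∏ i ∈ range n, ((1 + X ^ (3 * i + 1)) * (1 + X ^ (3 * i + 2))) with hA
  set B : ℤ⟦X⟧ := ∏ i ∈ range n, (1 + X ^ (3 * i + 3)) with hB
  set O : ℤ⟦X⟧ := ∏ i ∈ range n, (1 - X ^ (6 * i + 3)) with hO
  have hQ : ∏ i ∈ range (3 * n), (1 + X ^ (i + 1) : ℤ⟦X⟧) = A * B := by
    rw [prod_range_three_mul, hA, hB, ← prod_mul_distrib]
  have h1 := X_pow_dvd_sub_pentagonalSum n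
  have h2 := X_pow_dvd_sub_signedSquareSum n
  rw [prod_pow] at h2
  have hE : pochProd (X ^ 6 : ℤ⟦X⟧) n = pochProd (X ^ 3) n * B := by
    rw [pochProd, pochProd, hB, ← prod_mul_distrib]
    refine prod_congr rfl fun i _ ↦ ?_
    ring
  have hOE : pochProd (X ^ 3 : ℤ⟦X⟧) (2 * n) = O * pochProd (X ^ 6) n := by
    rw [pochProd, pochProd, prod_range_two_mul, hO, ← prod_mul_distrib]
    refine prod_congr rfl fun i _ ↦ ?_
    ring
  have h3 : (X : ℤ⟦X⟧) ^ (n + 1) ∣ pochProd (X ^ 3) (2 * n) - pochProd (X ^ 3) n :=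
    (pow_dvd_pow_of_dvd (dvd_pow_self X three_ne_zero) _).trans
      (pochProd_sub_dvd (X ^ 3) (show n ≤ 2 * n by omega))
  rw [hQ]
  rw [hOE] at h3
  -- With E₃, E₆ the two Pochhammer symbols: AB(1 + 2S) ≡ ABO·(O E₆) ≡ ABO·E₃ = A·(O E₆) ≡ A E₃ ≡ P,
  -- using O E₆ ≡ E₃ twice.
  have := (((h2.mul_left (A * B)).neg_right.add (h3.mul_left (A * B * O))).add
    (h3.mul_left A)).add h1
  refine this.trans (dvd_of_eq ?_)
  rw [hE]
  ring

theorem two_dvd_signedSquareSum_sub (n : ℕ) : 2 ∣ signedSquareSum n - squareSum n := by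
  rw [signedSquareSum, squareSum, ← sum_sub_distrib]
  refine dvd_sum fun m _ ↦ ?_
  rcases Nat.even_or_odd m with hm | hm
  · simp [hm.neg_one_pow]
  · rw [hm.neg_one_pow]
    exact ⟨-X ^ (3 * m ^ 2), by ring⟩

theorem exists_prod_eq_pentagonalSum_mul (n : ℕ) : ∃ F G : ℤ⟦X⟧,
    ∏ i ∈ range (3 * n), (1 + X ^ (i + 1)) =
      pentagonalSum n * (1 + 2 * squareSum n) + 4 * F + X ^ (n + 1) * G := by
  obtain ⟨G, hG⟩ := X_pow_dvd_prod_mul_sub_pentagonalSum n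
  obtain ⟨D, hD⟩ := two_dvd_signedSquareSum_sub n
  set S := signedSquareSum n
  -- Multiply `hG` by 1 + 2S, expand (1 + 2S)² = 1 + 4(S + S²), and substitute S = `squareSum n` +
  -- 2D.
  refine ⟨pentagonalSum n * D - (∏ i ∈ range (3 * n), (1 + X ^ (i + 1))) * (S + S ^ 2),
    G * (1 + 2 * S), ?_⟩
  linear_combination (1 + 2 * S) * hG + 2 * pentagonalSum n * hD

/-! ### Reading off coefficients -/

/-- Ensures that the window |j| ≤ n contains every index contributing to a coefficient N ≤ n. -/
theorem natAbs_le_pentagonal (j : ℤ) : j.natAbs ≤ pentagonal j := by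
  have := two_mul_natCast_pentagonal j
  zify
  rcases lt_trichotomy j 0 with h | h | h
  · rw [abs_of_neg h]; nlinarith
  · simp [h]
  · rw [abs_of_pos h]; nlinarith

theorem coeff_pentagonalSum {n N : ℕ} (h : N ≤ n) :
    coeff N (pentagonalSum n) = pentagonalIndicator N := by
  classical
  have hj (j : ℤ) (hj : N = pentagonal j) : j ∈ Icc (-n : ℤ) n := by
    have h1 := natAbs_le_pentagonal j
    rw [mem_Icc]
    omega
  simp only [pentagonalSum, map_sum, coeff_X_pow, pentagonalIndicator]
  split_ifs with hN
  · obtain ⟨t, ht⟩ := hN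
    rw [sum_eq_single_of_mem t (hj t ht)]
    · simp [ht]
    · intro j _ hjt
      rw [if_neg]
      rintro h'
      exact hjt (pentagonal_injective (h'.symm.trans ht))
  · rw [sum_eq_zero]
    · simp
    · intro j _
      exact if_neg fun h' ↦ hN ⟨j, h'⟩

theorem coeff_pentagonalSum_mul_squareSum {n N : ℕ} (h : N ≤ n) :
    coeff N (pentagonalSum n * squareSum n) = numPentagonalSquareReps N := by
  rw [pentagonalSum, squareSum, sum_mul_sum, ← sum_product', map_sum]
  simp only [← pow_add, coeff_X_pow]
  rw [sum_boole, numPentagonalSquareReps, Nat.cast_inj, ← Set.ncard_coe_finset]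
  refine Set.ncard_congr (fun p _ ↦ (pentagonal p.1, p.2 ^ 2)) ?_ ?_ ?_
  · rintro ⟨j, m⟩ hp
    simp at hp
    exact ⟨⟨j, rfl⟩, ⟨m, by omega, rfl⟩, hp.2.symm⟩
  · rintro ⟨j, m⟩ ⟨j', m'⟩ _ _ heq
    simpa using heq
  · rintro ⟨p, s⟩ ⟨⟨j, rfl⟩, ⟨m, hm, rfl⟩, hN⟩
    refine ⟨(j, m), ?_, rfl⟩
    have h1 := natAbs_le_pentagonal j
    have h2 : m ≤ m ^ 2 := Nat.le_self_pow two_ne_zero m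
    simp at hN ⊢
    omega

theorem mainTheorem10 (N : ℕ) (hN : 0 < N) :
    numDistinctPartitions N ≡
      pentagonalIndicator N + 2 * numPentagonalSquareReps N [MOD 4] := by
  obtain ⟨n₀, hn₀⟩ := exists_X_pow_dvd_numDistinctPartitions_sub N
  obtain ⟨H, hH⟩ := hn₀ (3 * max n₀ N) (by omega)
  obtain ⟨F, G, hFG⟩ := exists_prod_eq_pentagonalSum_mul (max n₀ N)
  have h : PowerSeries.mk (fun n ↦ (numDistinctPartitions n : ℤ)) =
      pentagonalSum (max n₀ N) + C 2 * (pentagonalSum (max n₀ N) * squareSum (max n₀ N)) +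
        C 4 * F + X ^ (max n₀ N + 1) * G + X ^ (N + 1) * H := by
    rw [show (C 2 : ℤ⟦X⟧) = 2 from rfl, show (C 4 : ℤ⟦X⟧) = 4 from rfl]
    linear_combination hH + hFG
  have hc := congrArg (coeff N) h
  simp only [map_add, coeff_mk, coeff_C_mul, coeff_X_pow_mul', coeff_pentagonalSum (le_max_right _ _),
    coeff_pentagonalSum_mul_squareSum (le_max_right _ _)] at hc
  -- Both truncation errors start beyond degree N.
  rw [if_neg (by omega), if_neg (by omega)] at hc
  refine (Nat.modEq_iff_dvd.2 ⟨coeff N F, ?_⟩).symm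
  push_cast
  linarith
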